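/- Let $\Lambda,z\in\mathbb R$ with $z\neq 0$. Let $\mathfrak g_\Lambda$ be the six-dimensional real Lie algebra with basis $P_0,P_1,P_2,K_1,K_2,J$ and brackets $$[J,P_i]=\epsilon_{ij}P_j,\quad [J,K_i]=\epsilon_{ij}K_j,\quad [J,P_0]=0,\quad [P_i,K_j]=-\delta_{ij}P_0,\quad [P_0,K_i]=-P_i,$$ $$[K_1,K_2]=-J,\quad [P_0,P_i]=-\Lambda K_i,\quad [P_1,P_2]=\Lambda J\qquad (i,j\in\{1,2\},\ \epsilon_{12}=-\epsilon_{21}=1,\ \epsilon_{11}=\epsilon_{22}=0),$$ with sums over the repeated index $j$ in the first two relations. Let $\mathfrak h=\mathrm{span}\{J,K_1,K_2\}$ and $\mathfrak t=\mathrm{span}\{P_0,P_1,P_2\}$, and equip $\mathfrak g_\Lambda$ with the cocommutator $\delta(X)=[X\otimes 1+1\otimes X,\,r]$, where $r=z(K_1\wedge P_1+K_2\wedge P_2)$ and $a\wedge b=a\otimes b-b\otimes a$ (the $(2+1)$-dimensional $\kappa$-Lie bialgebra, $z=1/\kappa$). Let $\mathfrak g^*$ be the dual space with the Lie bracket $[\cdot,\cdot]_*$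 given by $\langle[\phi,\psi]_*,X\rangle=\langle\phi\otimes\psi,\delta(X)\rangle$, and let $\mathfrak h^\perp,\mathfrak t^\perp\subset\mathfrak g^*$ be the annihilators of $\mathfrak h$ and $\mathfrak t$; then $\mathfrak g^*=\mathfrak h^\perp\oplus\mathfrak t^\perp$, $[\mathfrak h^\perp,\mathfrak h^\perp]_*\subseteq\mathfrak h^\perp$ and $[\mathfrak h^\perp,\mathfrak t^\perp]_*\subseteq\mathfrak t^\perp$. Let $G^*_\Lambda$ be a (Hausdorff) Lie group with Lie algebra $(\mathfrak g^*,[\cdot,\cdot]_*)$, let $H^\perp$ be a closed subgroup of $G^*_\Lambda$ with Lie algebra $\mathfrak h^\perp$, and let $M^\perp_\Lambda=G^*_\Lambda/H^\perp$ with its homogeneous manifold structure (the quotient map is a smooth submersion and the action of $G^*_\Lambda$ is smooth). Then $M^\perp_\Lambda$ admits no $G^*_\Lambda$-invariant smooth pseudo-Riemannian metric, of any signature. Equivalently, at the infinitesimal level: there is no nondegenerate symmetric bilinear form $\langle\cdot,\cdot\rangle$ on $\mathfrak t^\perp$ such that $$\langle[Z,X]_*,Y\rangle+\langle X,[Z,Y]_*\rangle=0\qquad\text{for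 all }X,Y\in\mathfrak t^\perp,\ Z\in\mathfrak h^\perp.$$ -/

import Mathlib

open scoped TensorProduct Manifold ContDiff

noncomputable section

/-! ### The Lorentzian Lie algebra in (2+1) dimensions -/

/-- The underlying space of the (2+1)-dimensional Lorentzian Lie algebra `𝔤_Λ` with cosmological
constant `Λ`. The coordinates `0, 1, 2, 3, 4, 5` are those with respect to the basis
`P₀, P₁, P₂, K₁, K₂, J`. -/
def LorentzLie (_Λ : ℝ) : Type := Fin 6 → ℝ

namespace LorentzLie

variable {Λ : ℝ}

instance : AddCommGroup (LorentzLie Λ) := inferInstanceAs (AddCommGroup (Fin 6 → ℝ))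
instance : Module ℝ (LorentzLie Λ) := inferInstanceAs (Module ℝ (Fin 6 → ℝ))
instance : Module.Finite ℝ (LorentzLie Λ) := inferInstanceAs (Module.Finite ℝ (Fin 6 → ℝ))

/-- The basis `P₀, P₁, P₂, K₁, K₂, J` of `𝔤_Λ`. -/
def gen (Λ : ℝ) : Module.Basis (Fin 6) ℝ (LorentzLie Λ) := Pi.basisFun ℝ (Fin 6)

def P0 (Λ : ℝ) : LorentzLie Λ := gen Λ 0
def P1 (Λ : ℝ) : LorentzLie Λ := gen Λ 1
def P2 (Λ : ℝ) : LorentzLie Λ := gen Λ 2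
def K1 (Λ : ℝ) : LorentzLie Λ := gen Λ 3
def K2 (Λ : ℝ) : LorentzLie Λ := gen Λ 4
def J (Λ : ℝ) : LorentzLie Λ := gen Λ 5

/-- The Lie bracket of `𝔤_Λ` in coordinates; the brackets of the generators are listed in
`lie_table` below. -/
instance : Bracket (LorentzLie Λ) (LorentzLie Λ) where
  bracket u v :=
    let w : Fin 6 → Fin 6 → ℝ := fun i j => u i * v j - u j * v i
    (![-w 1 3 - w 2 4, -w 5 2 - w 0 3, w 5 1 - w 0 4,
      -w 5 4 - Λ * w 0 1, w 5 3 - Λ * w 0 2, -w 3 4 + Λ * w 1 2] : Fin 6 → ℝ)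

theorem add_apply (u v : LorentzLie Λ) (i : Fin 6) : (u + v) i = u i + v i := rfl
theorem smul_apply (c : ℝ) (v : LorentzLie Λ) (i : Fin 6) : (c • v) i = c * v i := rfl
theorem neg_apply (v : LorentzLie Λ) (i : Fin 6) : (-v) i = -v i := rfl
theorem zero_apply (i : Fin 6) : (0 : LorentzLie Λ) i = 0 := rfl

theorem gen_apply (i j : Fin 6) : gen Λ i j = if j = i then 1 else 0 := by
  change (Pi.basisFun ℝ (Fin 6) i) j = _
  simp [Pi.single_apply]

theorem lie_apply_zero (u v : LorentzLie Λ) :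
    ⁅u, v⁆ 0 = -(u 1 * v 3 - u 3 * v 1) - (u 2 * v 4 - u 4 * v 2) := rfl
theorem lie_apply_one (u v : LorentzLie Λ) :
    ⁅u, v⁆ 1 = -(u 5 * v 2 - u 2 * v 5) - (u 0 * v 3 - u 3 * v 0) := rfl
theorem lie_apply_two (u v : LorentzLie Λ) :
    ⁅u, v⁆ 2 = (u 5 * v 1 - u 1 * v 5) - (u 0 * v 4 - u 4 * v 0) := rfl
theorem lie_apply_three (u v : LorentzLie Λ) :
    ⁅u, v⁆ 3 = -(u 5 * v 4 - u 4 * v 5) - Λ * (u 0 * v 1 - u 1 * v 0) := rfl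
theorem lie_apply_four (u v : LorentzLie Λ) :
    ⁅u, v⁆ 4 = (u 5 * v 3 - u 3 * v 5) - Λ * (u 0 * v 2 - u 2 * v 0) := rfl
theorem lie_apply_five (u v : LorentzLie Λ) :
    ⁅u, v⁆ 5 = -(u 3 * v 4 - u 4 * v 3) + Λ * (u 1 * v 2 - u 2 * v 1) := rfl

theorem ext_coord {u v : LorentzLie Λ} (h0 : u 0 = v 0) (h1 : u 1 = v 1) (h2 : u 2 = v 2)
    (h3 : u 3 = v 3) (h4 : u 4 = v 4) (h5 : u 5 = v 5) : u = v := by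
  funext i
  fin_cases i
  exacts [h0, h1, h2, h3, h4, h5]

instance : LieRing (LorentzLie Λ) where
  add_lie u v w := by
    apply ext_coord <;> simp only [add_apply, lie_apply_zero, lie_apply_one, lie_apply_two,
      lie_apply_three, lie_apply_four, lie_apply_five] <;> ring
  lie_add u v w := by
    apply ext_coord <;> simp only [add_apply, lie_apply_zero, lie_apply_one, lie_apply_two,
      lie_apply_three, lie_apply_four, lie_apply_five] <;> ring
  lie_self u := by
    apply ext_coord <;> simp only [zero_apply, lie_apply_zero, lie_apply_one, lie_apply_two,
      lie_apply_three, lie_apply_four, lie_apply_five] <;> ring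
  leibniz_lie u v w := by
    apply ext_coord <;> simp only [add_apply, lie_apply_zero, lie_apply_one, lie_apply_two,
      lie_apply_three, lie_apply_four, lie_apply_five] <;> ring

instance : LieAlgebra ℝ (LorentzLie Λ) where
  lie_smul c u v := by
    apply ext_coord <;> simp only [smul_apply, lie_apply_zero, lie_apply_one, lie_apply_two,
      lie_apply_three, lie_apply_four, lie_apply_five] <;> ring

/-- The commutation relations of `𝔤_Λ`. -/
theorem lie_table :
    ⁅J Λ, P1 Λ⁆ = P2 Λ ∧ ⁅J Λ, P2 Λ⁆ = -P1 Λ ∧ ⁅J Λ, K1 Λ⁆ = K2 Λ ∧ ⁅J Λ, K2 Λ⁆ = -K1 Λ ∧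
    ⁅J Λ, P0 Λ⁆ = 0 ∧
    ⁅P1 Λ, K1 Λ⁆ = -P0 Λ ∧ ⁅P2 Λ, K2 Λ⁆ = -P0 Λ ∧ ⁅P1 Λ, K2 Λ⁆ = 0 ∧ ⁅P2 Λ, K1 Λ⁆ = 0 ∧
    ⁅P0 Λ, K1 Λ⁆ = -P1 Λ ∧ ⁅P0 Λ, K2 Λ⁆ = -P2 Λ ∧ ⁅K1 Λ, K2 Λ⁆ = -J Λ ∧
    ⁅P0 Λ, P1 Λ⁆ = -(Λ • K1 Λ) ∧ ⁅P0 Λ, P2 Λ⁆ = -(Λ • K2 Λ) ∧ ⁅P1 Λ, P2 Λ⁆ = Λ • J Λ := by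
  refine ⟨?_, ?_, ?_, ?_, ?_, ?_, ?_, ?_, ?_, ?_, ?_, ?_, ?_, ?_, ?_⟩ <;>
    apply ext_coord <;>
    simp [lie_apply_zero, lie_apply_one, lie_apply_two, lie_apply_three, lie_apply_four,
      lie_apply_five, P0, P1, P2, K1, K2, J, gen_apply, neg_apply, smul_apply, zero_apply]

/-- The Lorentz subalgebra `𝔥 = span {J, K₁, K₂}`. -/
def lorentzSub (Λ : ℝ) : Submodule ℝ (LorentzLie Λ) := Submodule.span ℝ {J Λ, K1 Λ, K2 Λ}

/-- The complement `𝔱 = span {P₀, P₁, P₂}` of translation generators. -/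
def translations (Λ : ℝ) : Submodule ℝ (LorentzLie Λ) := Submodule.span ℝ {P0 Λ, P1 Λ, P2 Λ}

/-! ### The κ-Lie bialgebra structure -/

/-- `a ∧ b = a ⊗ b - b ⊗ a`. -/
def wedge (a b : LorentzLie Λ) : LorentzLie Λ ⊗[ℝ] LorentzLie Λ := a ⊗ₜ[ℝ] b - b ⊗ₜ[ℝ] a

/-- The `r`-matrix `r = z (K₁ ∧ P₁ + K₂ ∧ P₂)` of the κ-deformation. -/
def rMatrix (Λ z : ℝ) : LorentzLie Λ ⊗[ℝ] LorentzLie Λ :=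
  z • (wedge (K1 Λ) (P1 Λ) + wedge (K2 Λ) (P2 Λ))

/-- The coboundary cocommutator `δ(X) = [X ⊗ 1 + 1 ⊗ X, r]`, i.e. the diagonal adjoint action of
`X` on `r`. -/
def cocommutator (Λ z : ℝ) : LorentzLie Λ →ₗ[ℝ] LorentzLie Λ ⊗[ℝ] LorentzLie Λ where
  toFun X := ⁅X, rMatrix Λ z⁆
  map_add' X Y := add_lie X Y _
  map_smul' c X := smul_lie c X _

/-- The values of the cocommutator on the generators. -/
theorem cocommutator_table (z : ℝ) :
    cocommutator Λ z (P0 Λ) = 0 ∧ cocommutator Λ z (J Λ) = 0 ∧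
    cocommutator Λ z (P1 Λ) = z • (wedge (P1 Λ) (P0 Λ) + Λ • wedge (K2 Λ) (J Λ)) ∧
    cocommutator Λ z (P2 Λ) = z • (wedge (P2 Λ) (P0 Λ) - Λ • wedge (K1 Λ) (J Λ)) ∧
    cocommutator Λ z (K1 Λ) = z • (wedge (K1 Λ) (P0 Λ) + wedge (P2 Λ) (J Λ)) ∧
    cocommutator Λ z (K2 Λ) = z • (wedge (K2 Λ) (P0 Λ) - wedge (P1 Λ) (J Λ)) := by
  obtain ⟨h1, h2, h3, h4, -, h6, h7, h8, h9, h10, h11, h12, h13, h14, h15⟩ := lie_table (Λ := Λ)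
  have a6 : ⁅K1 Λ, P1 Λ⁆ = P0 Λ := by rw [← lie_skew, h6, neg_neg]
  have a7 : ⁅K2 Λ, P2 Λ⁆ = P0 Λ := by rw [← lie_skew, h7, neg_neg]
  have a8 : ⁅K2 Λ, P1 Λ⁆ = 0 := by rw [← lie_skew, h8, neg_zero]
  have a9 : ⁅K1 Λ, P2 Λ⁆ = 0 := by rw [← lie_skew, h9, neg_zero]
  have a12 : ⁅K2 Λ, K1 Λ⁆ = J Λ := by rw [← lie_skew, h12, neg_neg]
  have a15 : ⁅P2 Λ, P1 Λ⁆ = -(Λ • J Λ) := by rw [← lie_skew, h15]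
  refine ⟨?_, ?_, ?_, ?_, ?_, ?_⟩ <;>
  · simp only [cocommutator, rMatrix, wedge, LinearMap.coe_mk, AddHom.coe_mk, lie_smul, lie_add,
      lie_sub, TensorProduct.LieModule.lie_tmul_right, h1, h2, h3, h4, h6, h7, h8, h9, h10, h11,
      h12, h13, h14, h15, a6, a7, a8, a9, a12, a15, lie_self, TensorProduct.neg_tmul,
      TensorProduct.tmul_neg, ← TensorProduct.smul_tmul', TensorProduct.tmul_smul,
      TensorProduct.zero_tmul, TensorProduct.tmul_zero]
    module

end LorentzLie

/-! ### The dual Lie algebra -/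

/-- The dual space `𝔤*` of `𝔤_Λ`, which will carry the Lie bracket `[·,·]_*` dual to the
cocommutator with deformation parameter `z`. -/
def DualLie (Λ _z : ℝ) : Type := Module.Dual ℝ (LorentzLie Λ)

namespace DualLie

open LorentzLie

variable {Λ z : ℝ}

instance : AddCommGroup (DualLie Λ z) := inferInstanceAs (AddCommGroup (Module.Dual ℝ (LorentzLie Λ)))
instance : Module ℝ (DualLie Λ z) := inferInstanceAs (Module ℝ (Module.Dual ℝ (LorentzLie Λ)))
instance : FunLike (DualLie Λ z) (LorentzLie Λ) ℝ :=
  inferInstanceAs (FunLike (Module.Dual ℝ (LorentzLie Λ)) (LorentzLie Λ) ℝ)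

/-- The dual bracket is the transpose of the cocommutator:
`⟨[φ, ψ]_*, X⟩ = ⟨φ ⊗ ψ, δ(X)⟩`. -/
instance : Bracket (DualLie Λ z) (DualLie Λ z) where
  bracket φ ψ := (TensorProduct.dualDistrib ℝ (LorentzLie Λ) (LorentzLie Λ)
    ((φ : Module.Dual ℝ (LorentzLie Λ)) ⊗ₜ[ℝ] (ψ : Module.Dual ℝ (LorentzLie Λ)))) ∘ₗ
      cocommutator Λ z

theorem add_apply (φ ψ : DualLie Λ z) (X : LorentzLie Λ) : (φ + ψ) X = φ X + ψ X := rfl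
theorem smul_apply (c : ℝ) (φ : DualLie Λ z) (X : LorentzLie Λ) : (c • φ) X = c * φ X := rfl
theorem zero_apply (X : LorentzLie Λ) : (0 : DualLie Λ z) X = 0 := rfl

theorem ext_gen {φ ψ : DualLie Λ z} (h0 : φ (P0 Λ) = ψ (P0 Λ)) (h1 : φ (P1 Λ) = ψ (P1 Λ))
    (h2 : φ (P2 Λ) = ψ (P2 Λ)) (h3 : φ (K1 Λ) = ψ (K1 Λ)) (h4 : φ (K2 Λ) = ψ (K2 Λ))
    (h5 : φ (J Λ) = ψ (J Λ)) : φ = ψ := by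
  refine (gen Λ).ext (fun i => ?_)
  fin_cases i
  exacts [h0, h1, h2, h3, h4, h5]

theorem lie_apply (φ ψ : DualLie Λ z) (X : LorentzLie Λ) :
    ⁅φ, ψ⁆ X = TensorProduct.dualDistrib ℝ (LorentzLie Λ) (LorentzLie Λ)
      ((φ : Module.Dual ℝ (LorentzLie Λ)) ⊗ₜ[ℝ] (ψ : Module.Dual ℝ (LorentzLie Λ)))
        (cocommutator Λ z X) := rfl

theorem dualDistrib_wedge (φ ψ : DualLie Λ z) (a b : LorentzLie Λ) :
    TensorProduct.dualDistrib ℝ (LorentzLie Λ) (LorentzLie Λ)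
      ((φ : Module.Dual ℝ (LorentzLie Λ)) ⊗ₜ[ℝ] (ψ : Module.Dual ℝ (LorentzLie Λ)))
        (wedge a b) = φ a * ψ b - φ b * ψ a := by
  rw [wedge, map_sub]
  rfl

theorem lie_P0 (φ ψ : DualLie Λ z) : ⁅φ, ψ⁆ (P0 Λ) = 0 := by
  rw [lie_apply, (cocommutator_table z).1, map_zero]

theorem lie_J (φ ψ : DualLie Λ z) : ⁅φ, ψ⁆ (J Λ) = 0 := by
  rw [lie_apply, (cocommutator_table z).2.1, map_zero]

theorem lie_P1 (φ ψ : DualLie Λ z) : ⁅φ, ψ⁆ (P1 Λ) =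
    z * ((φ (P1 Λ) * ψ (P0 Λ) - φ (P0 Λ) * ψ (P1 Λ)) +
      Λ * (φ (K2 Λ) * ψ (J Λ) - φ (J Λ) * ψ (K2 Λ))) := by
  rw [lie_apply, (cocommutator_table z).2.2.1, map_smul, map_add, map_smul, dualDistrib_wedge,
    dualDistrib_wedge, smul_eq_mul, smul_eq_mul]

theorem lie_P2 (φ ψ : DualLie Λ z) : ⁅φ, ψ⁆ (P2 Λ) =
    z * ((φ (P2 Λ) * ψ (P0 Λ) - φ (P0 Λ) * ψ (P2 Λ)) -
      Λ * (φ (K1 Λ) * ψ (J Λ) - φ (J Λ) * ψ (K1 Λ))) := by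
  rw [lie_apply, (cocommutator_table z).2.2.2.1, map_smul, map_sub, map_smul, dualDistrib_wedge,
    dualDistrib_wedge, smul_eq_mul, smul_eq_mul]

theorem lie_K1 (φ ψ : DualLie Λ z) : ⁅φ, ψ⁆ (K1 Λ) =
    z * ((φ (K1 Λ) * ψ (P0 Λ) - φ (P0 Λ) * ψ (K1 Λ)) +
      (φ (P2 Λ) * ψ (J Λ) - φ (J Λ) * ψ (P2 Λ))) := by
  rw [lie_apply, (cocommutator_table z).2.2.2.2.1, map_smul, map_add, dualDistrib_wedge,
    dualDistrib_wedge, smul_eq_mul]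

theorem lie_K2 (φ ψ : DualLie Λ z) : ⁅φ, ψ⁆ (K2 Λ) =
    z * ((φ (K2 Λ) * ψ (P0 Λ) - φ (P0 Λ) * ψ (K2 Λ)) -
      (φ (P1 Λ) * ψ (J Λ) - φ (J Λ) * ψ (P1 Λ))) := by
  rw [lie_apply, (cocommutator_table z).2.2.2.2.2, map_smul, map_sub, dualDistrib_wedge,
    dualDistrib_wedge, smul_eq_mul]

instance : LieRing (DualLie Λ z) where
  add_lie φ ψ χ := by
    apply ext_gen <;> simp only [add_apply, lie_P0, lie_P1, lie_P2, lie_K1, lie_K2, lie_J] <;> ring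
  lie_add φ ψ χ := by
    apply ext_gen <;> simp only [add_apply, lie_P0, lie_P1, lie_P2, lie_K1, lie_K2, lie_J] <;> ring
  lie_self φ := by
    apply ext_gen <;> simp only [zero_apply, lie_P0, lie_P1, lie_P2, lie_K1, lie_K2, lie_J] <;> ring
  leibniz_lie φ ψ χ := by
    apply ext_gen <;> simp only [add_apply, lie_P0, lie_P1, lie_P2, lie_K1, lie_K2, lie_J] <;> ring

instance : LieAlgebra ℝ (DualLie Λ z) where
  lie_smul c φ ψ := by
    apply ext_gen <;> simp only [smul_apply, lie_P0, lie_P1, lie_P2, lie_K1, lie_K2, lie_J] <;> ring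

/-- The annihilator `𝔥^⊥` of the Lorentz subalgebra `𝔥` in `𝔤*`. -/
def hPerp (Λ z : ℝ) : Submodule ℝ (DualLie Λ z) :=
  (lorentzSub Λ).dualAnnihilator

/-- The annihilator `𝔱^⊥` of the translation part `𝔱` in `𝔤*`. -/
def tPerp (Λ z : ℝ) : Submodule ℝ (DualLie Λ z) :=
  (translations Λ).dualAnnihilator

theorem mem_span_ann {a b c : LorentzLie Λ} (φ : DualLie Λ z) :
    (∀ X ∈ Submodule.span ℝ {a, b, c}, φ X = 0) ↔ φ a = 0 ∧ φ b = 0 ∧ φ c = 0 := by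
  constructor
  · intro h
    exact ⟨h a (Submodule.subset_span (by simp)), h b (Submodule.subset_span (by simp)),
      h c (Submodule.subset_span (by simp))⟩
  · rintro ⟨ha, hb, hc⟩ X hX
    have hle : Submodule.span ℝ {a, b, c} ≤
        LinearMap.ker (φ : Module.Dual ℝ (LorentzLie Λ)) := by
      rw [Submodule.span_le]
      rintro x (rfl | rfl | rfl)
      exacts [ha, hb, hc]
    exact hle hX

theorem mem_hPerp {φ : DualLie Λ z} :
    φ ∈ hPerp Λ z ↔ φ (J Λ) = 0 ∧ φ (K1 Λ) = 0 ∧ φ (K2 Λ) = 0 :=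
  (Submodule.mem_dualAnnihilator _).trans (mem_span_ann φ)

theorem mem_tPerp {φ : DualLie Λ z} :
    φ ∈ tPerp Λ z ↔ φ (P0 Λ) = 0 ∧ φ (P1 Λ) = 0 ∧ φ (P2 Λ) = 0 :=
  (Submodule.mem_dualAnnihilator _).trans (mem_span_ann φ)

/-- Reductivity of the dual: `[𝔥^⊥, 𝔱^⊥]_* ⊆ 𝔱^⊥`. -/
theorem lie_mem_tPerp {Z X : DualLie Λ z} (hZ : Z ∈ hPerp Λ z) (hX : X ∈ tPerp Λ z) :
    ⁅Z, X⁆ ∈ tPerp Λ z := by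
  obtain ⟨z1, z2, z3⟩ := mem_hPerp.1 hZ
  obtain ⟨x1, x2, x3⟩ := mem_tPerp.1 hX
  refine mem_tPerp.2 ⟨lie_P0 _ _, ?_, ?_⟩
  · rw [lie_P1, z1, z3, x1, x2]; ring
  · rw [lie_P2, z1, z2, x1, x3]; ring

/-- The isotropy action `ad_Z : 𝔱^⊥ → 𝔱^⊥`, `X ↦ [Z, X]_*`, of `Z ∈ 𝔥^⊥`. -/
def isotropyAd (Z : hPerp Λ z) (X : tPerp Λ z) : tPerp Λ z :=
  ⟨⁅(Z : DualLie Λ z), (X : DualLie Λ z)⁆, lie_mem_tPerp Z.2 X.2⟩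

/-- `ad_{𝔥^⊥}`-invariance of a bilinear form on `𝔱^⊥`:
`⟨[Z, X]_*, Y⟩ + ⟨X, [Z, Y]_*⟩ = 0` for all `X, Y ∈ 𝔱^⊥` and `Z ∈ 𝔥^⊥`. -/
def IsAdInvariant (B : LinearMap.BilinForm ℝ (tPerp Λ z)) : Prop :=
  ∀ (Z : hPerp Λ z) (X Y : tPerp Λ z), B (isotropyAd Z X) Y + B X (isotropyAd Z Y) = 0

end DualLie

/-! ### Homogeneous spaces and invariant metrics -/

/-- A smooth Lie group is regular enough for its tangent space at `1` to carry Mathlib's Lie algebra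
structure. -/
instance instLEInftyMinSmoothnessReal : ENat.LEInfty (minSmoothness ℝ 3) :=
  ⟨by
    rw [minSmoothness_of_isRCLikeNormedField]
    exact ENat.LEInfty.out⟩

section Geometry

variable {E : Type*} [NormedAddCommGroup E] [NormedSpace ℝ E]
  {F : Type*} [NormedAddCommGroup F] [NormedSpace ℝ F]

/-- The Lie algebra of a (closed) subgroup `H` of a Lie group `G`, as a subset of the Lie algebra of
`G`: all `X` with `exp (t X) ∈ H` for every real `t`. The one-parameter subgroup `t ↦ exp (t X)` is
the integral curve through `1` of the left-invariant vector field defined by `X`. -/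
def subgroupLieAlgebra {G : Type*} [TopologicalSpace G] [ChartedSpace E G] [Group G]
    (H : Subgroup G) : Set (GroupLieAlgebra 𝓘(ℝ, E) G) :=
  {X | ∃ γ : ℝ → G, γ 0 = 1 ∧ IsMIntegralCurve (I := 𝓘(ℝ, E)) γ (mulInvariantVectorField X) ∧
    ∀ t, γ t ∈ H}

/-- The given charts define the standard manifold structure on the homogeneous space `G ⧸ H` (with
its quotient topology): the projection `G → G ⧸ H` is a smooth submersion and the action of `G` is
smooth. -/
structure IsHomogeneousManifold (E F : Type*) [NormedAddCommGroup E] [NormedSpace ℝ E]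
    [NormedAddCommGroup F] [NormedSpace ℝ F]
    {G : Type*} [TopologicalSpace G] [ChartedSpace E G] [Group G]
    (H : Subgroup G) [ChartedSpace F (G ⧸ H)] : Prop where
  contMDiff_mk : ContMDiff 𝓘(ℝ, E) 𝓘(ℝ, F) ∞ (fun g : G => (g : G ⧸ H))
  surjective_mfderiv_mk : ∀ g : G,
    Function.Surjective (mfderiv 𝓘(ℝ, E) 𝓘(ℝ, F) (fun g : G => (g : G ⧸ H)) g)
  contMDiff_smul : ContMDiff (𝓘(ℝ, E).prod 𝓘(ℝ, F)) 𝓘(ℝ, F) ∞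
    (fun p : G × (G ⧸ H) => p.1 • p.2)

/-- A smooth pseudo-Riemannian metric (of any signature) on a manifold modelled on `F`. -/
structure PseudoRiemannianMetric (F : Type*) [NormedAddCommGroup F] [NormedSpace ℝ F]
    (M : Type*) [TopologicalSpace M] [ChartedSpace F M] [IsManifold 𝓘(ℝ, F) ∞ M] where
  form (x : M) : TangentSpace 𝓘(ℝ, F) x →L[ℝ] TangentSpace 𝓘(ℝ, F) x →L[ℝ] ℝ
  symm (x : M) (v w : TangentSpace 𝓘(ℝ, F) x) : form x v w = form x w v
  nondegenerate (x : M) (v : TangentSpace 𝓘(ℝ, F) x) (hv : ∀ w, form x v w = 0) : v = 0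
  contMDiff : ContMDiff 𝓘(ℝ, F) (𝓘(ℝ, F).prod 𝓘(ℝ, F →L[ℝ] F →L[ℝ] ℝ)) ∞
    (fun x => Bundle.TotalSpace.mk' (F →L[ℝ] F →L[ℝ] ℝ)
      (E := fun x : M => TangentSpace 𝓘(ℝ, F) x →L[ℝ] TangentSpace 𝓘(ℝ, F) x →L[ℝ] ℝ)
      x (form x))

/-- A metric on a `G`-space is `G`-invariant if every `a : G` acts by isometries. -/
def PseudoRiemannianMetric.IsInvariant (G : Type*) [Group G] {M : Type*} [TopologicalSpace M]
    [ChartedSpace F M] [IsManifold 𝓘(ℝ, F) ∞ M] [MulAction G M] (g : PseudoRiemannianMetric F M) : Prop :=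
  ∀ (a : G) (x : M) (v w : TangentSpace 𝓘(ℝ, F) x),
    g.form (a • x) (mfderiv 𝓘(ℝ, F) 𝓘(ℝ, F) (fun y : M => a • y) x v)
      (mfderiv 𝓘(ℝ, F) 𝓘(ℝ, F) (fun y : M => a • y) x w) = g.form x v w

end Geometry

end

/-! Let `p` and `k` be the elements of the dual basis of `𝔤*` corresponding to `P₀` and `K₁`, so
that `p ∈ 𝔥^⊥` and `k ∈ 𝔱^⊥`. On all of `𝔤*`, `ad p` is `-z` times a projection, and `k` lies in its
image: `[p, k]_* = -z k`. Skewness of `ad p` forces opposite eigenvalues to be paired, but `-z`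
occurs and `z` does not; hence `k` lies in the kernel of every form for which `ad p` is skew
(`LinearMap.BilinForm.apply_eq_zero_of_skew_of_eigenvector`). On `𝔱^⊥` this contradicts
nondegeneracy at once.

For the metric, let `π : G → G ⧸ H`, and pull the form at the base point back along `dπ` to a form
on the whole Lie algebra. By `form_lie_add_form_lie` it is invariant under `Lie H`, so `k` is in its
kernel. Nondegeneracy and surjectivity of `dπ` give `dπ k = 0`, and `mem_subgroupLieAlgebra` then
puts `k` in `𝔥^⊥`, although `k(K₁) = 1`.

Infinitesimal invariance comes from differentiating the metric on translated vectors along a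
one-parameter subgroup in `H`. The adjoint representation is avoided: `π` is constant along the
left-invariant field of `X ∈ Lie H`, and for a map constant along `V` the derivative of `df(W)`
along `V` is `df([V, W])`. -/

open Set Filter Topology VectorField

/-! ### Lie brackets and maps that are constant along a vector field -/

section VectorFields

variable {E : Type*} [NormedAddCommGroup E] [NormedSpace ℝ E]
  {F : Type*} [NormedAddCommGroup F] [NormedSpace ℝ F]

/-- If `f` is constant along `V`, then the derivative along `V` of the derivative of `f` along `W`
is the derivative of `f` along `[V, W]`. -/
theorem hasFDerivAt_fderiv_apply_lieBracket {f : E → F} {V W : E → E} {x : E}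
    (hf : ContDiffAt ℝ 2 f x) (hV : DifferentiableAt ℝ V x) (hW : DifferentiableAt ℝ W x)
    (h0 : ∀ᶠ y in 𝓝 x, fderiv ℝ f y (V y) = 0) :
    ∃ L : E →L[ℝ] F, HasFDerivAt (fun y => fderiv ℝ f y (W y)) L x ∧
      L (V x) = fderiv ℝ f x (lieBracket ℝ V W x) := by
  have hd : DifferentiableAt ℝ (fderiv ℝ f) x :=
    (hf.fderiv_right (m := 1) le_rfl).differentiableAt one_ne_zero
  have hs : IsSymmSndFDerivAt ℝ f x := hf.isSymmSndFDerivAt (by simp)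
  have hWd := hd.hasFDerivAt.clm_apply hW.hasFDerivAt
  have hVd := hd.hasFDerivAt.clm_apply hV.hasFDerivAt
  have hz := hVd.unique ((hasFDerivAt_const (0 : F) x).congr_of_eventuallyEq h0)
  refine ⟨_, hWd, ?_⟩
  -- Differentiating `df(V) = 0` along `W` gives `D²f(W, V) + df(DV·W) = 0`. By symmetry of `D²f`,
  -- the derivative `D²f(V, W) + df(DW·V)` equals `df(DW·V - DV·W)`.
  have hz' := DFunLike.congr_fun hz (W x)
  simp only [add_apply, ContinuousLinearMap.comp_apply,
    ContinuousLinearMap.flip_apply, zero_apply] at hz' ⊢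
  rw [lieBracket, map_sub, hs (V x) (W x), sub_eq_add_neg, add_right_inj]
  exact eq_neg_of_add_eq_zero_right hz'

variable [CompleteSpace E] {M : Type*} [TopologicalSpace M] [ChartedSpace E M]
  [IsManifold 𝓘(ℝ, E) 2 M]

/-- If `f` is constant along `V`, and `γ` is a curve tangent to `V` at `t₀`, then the derivative
at `t₀` of `df (W)` along `γ` is `df ([V, W])`. -/
theorem hasDerivAt_mfderiv_apply_mlieBracket {f : M → F}
    {V W : Π y : M, TangentSpace 𝓘(ℝ, E) y} {γ : ℝ → M} {t₀ : ℝ}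
    (hf : ContMDiffAt 𝓘(ℝ, E) 𝓘(ℝ, F) 2 f (γ t₀))
    (hV : MDifferentiableAt 𝓘(ℝ, E) 𝓘(ℝ, E).tangent
      (fun y => (V y : TangentBundle 𝓘(ℝ, E) M)) (γ t₀))
    (hW : MDifferentiableAt 𝓘(ℝ, E) 𝓘(ℝ, E).tangent
      (fun y => (W y : TangentBundle 𝓘(ℝ, E) M)) (γ t₀))
    (h0 : ∀ᶠ y in 𝓝 (γ t₀), mfderiv 𝓘(ℝ, E) 𝓘(ℝ, F) f y (V y) = 0)
    (hγ : HasMFDerivAt 𝓘(ℝ, ℝ) 𝓘(ℝ, E) γ t₀ ((1 : ℝ →L[ℝ] ℝ).smulRight (V (γ t₀)))) :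
    HasDerivAt (fun t => (mfderiv 𝓘(ℝ, E) 𝓘(ℝ, F) f (γ t) (W (γ t)) : F))
      (mfderiv 𝓘(ℝ, E) 𝓘(ℝ, F) f (γ t₀) (mlieBracket 𝓘(ℝ, E) V W (γ t₀))) t₀ := by
  have : IsManifold 𝓘(ℝ, E) 1 M := IsManifold.of_le (n := 2) one_le_two
  set x := γ t₀ with hx
  set φ := extChartAt 𝓘(ℝ, E) x with hφ
  -- These are the chart representatives through which `mlieBracket` is defined.
  set V' : E → E := mpullbackWithin 𝓘(ℝ, E) 𝓘(ℝ, E) φ.symm V (range 𝓘(ℝ, E)) with hV'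
  set W' : E → E := mpullbackWithin 𝓘(ℝ, E) 𝓘(ℝ, E) φ.symm W (range 𝓘(ℝ, E)) with hW'
  have dV : DifferentiableAt ℝ V' (φ x) := by
    have := hV.mdifferentiableWithinAt (s := univ)
      |>.differentiableWithinAt_mpullbackWithin_vectorField
    rw [preimage_univ, univ_inter] at this
    exact this.differentiableAt (by simp)
  have dW : DifferentiableAt ℝ W' (φ x) := by
    have := hW.mdifferentiableWithinAt (s := univ)
      |>.differentiableWithinAt_mpullbackWithin_vectorField
    rw [preimage_univ, univ_inter] at this
    exact this.differentiableAt (by simp)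
  set p : E → F := f ∘ φ.symm with hp
  have xs : φ.symm (φ x) = x := extChartAt_to_inv x
  have cp : ContDiffAt ℝ 2 p (φ x) := by
    have h1 : ContMDiffAt 𝓘(ℝ, E) 𝓘(ℝ, E) 2 φ.symm (φ x) := by
      have := contMDiffWithinAt_extChartAt_symm_range (I := 𝓘(ℝ, E)) (n := 2) x
        (mem_extChartAt_target x)
      exact this.contMDiffAt (by simp)
    have h2 : ContMDiffAt 𝓘(ℝ, E) 𝓘(ℝ, F) 2 f (φ.symm (φ x)) := by rwa [xs]
    exact (h2.comp _ h1).contDiffAt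
  -- near `x`, `df` applied to a vector field can be computed in the chart
  have hfd : ∀ᶠ y in 𝓝 x, MDifferentiableAt 𝓘(ℝ, E) 𝓘(ℝ, F) f y := by
    filter_upwards [(contMDiffAt_iff_contMDiffAt_nhds (by simp)).1 hf] with y hy
    exact hy.mdifferentiableAt (by simp)
  -- The chart pullback applies the inverse of the derivative of `φ.symm`, which cancels against the
  -- chain rule for `f ∘ φ.symm`. One neighbourhood serves all fields `U`: `V`, `W` and their
  -- bracket.
  have key : ∀ᶠ y in 𝓝 x, ∀ U : Π y : M, TangentSpace 𝓘(ℝ, E) y,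
      fderiv ℝ p (φ y) (mpullbackWithin 𝓘(ℝ, E) 𝓘(ℝ, E) φ.symm U (range 𝓘(ℝ, E)) (φ y)) =
        mfderiv 𝓘(ℝ, E) 𝓘(ℝ, F) f y (U y) := by
    filter_upwards [hfd, extChartAt_source_mem_nhds (I := 𝓘(ℝ, E)) x] with y hy hys U
    have ht : φ y ∈ φ.target := φ.map_source hys
    have ys : φ.symm (φ y) = y := φ.left_inv hys
    have hinv := isInvertible_mfderivWithin_extChartAt_symm (I := 𝓘(ℝ, E)) ht
    have hsd : MDifferentiableAt 𝓘(ℝ, E) 𝓘(ℝ, E) φ.symm (φ y) := by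
      have := mdifferentiableWithinAt_extChartAt_symm (I := 𝓘(ℝ, E)) ht
      exact this.mdifferentiableAt (by simp)
    have h2 : MDifferentiableAt 𝓘(ℝ, E) 𝓘(ℝ, F) f (φ.symm (φ y)) := by rwa [ys]
    rw [← mfderiv_eq_fderiv, hp, mfderiv_comp _ h2 hsd]
    change mfderiv 𝓘(ℝ, E) 𝓘(ℝ, F) f (φ.symm (φ y)) (mfderiv 𝓘(ℝ, E) 𝓘(ℝ, E) φ.symm (φ y)
      ((mfderivWithin 𝓘(ℝ, E) 𝓘(ℝ, E) φ.symm (range 𝓘(ℝ, E)) (φ y)).inverse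
        (U (φ.symm (φ y))))) = _
    have e1 : mfderiv 𝓘(ℝ, E) 𝓘(ℝ, E) φ.symm (φ y) =
        mfderivWithin 𝓘(ℝ, E) 𝓘(ℝ, E) φ.symm (range 𝓘(ℝ, E)) (φ y) := by
      simp [mfderivWithin_univ]
    rw [e1, hinv.self_apply_inverse, ys]
  have hcs : ∀ᶠ q in 𝓝 (φ x), fderiv ℝ p q (V' q) = 0 := by
    have hc : Tendsto φ.symm (𝓝 (φ x)) (𝓝 x) := by
      have := continuousAt_extChartAt_symm (I := 𝓘(ℝ, E)) x
      rwa [ContinuousAt, xs] at this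
    filter_upwards [hc.eventually key, hc.eventually h0,
      extChartAt_target_mem_nhds (I := 𝓘(ℝ, E)) x] with q hq1 hq2 hq3
    have := hq1 V
    rw [φ.right_inv hq3] at this
    rw [hV', this]
    exact hq2
  obtain ⟨L, hL, hLV⟩ := hasFDerivAt_fderiv_apply_lieBracket cp dV dW hcs
  -- The tangent space at `x` is identified with `E` through the chart at `x` itself, so at this one
  -- point passing to the chart changes no vector.
  have hφd : HasMFDerivAt 𝓘(ℝ, E) 𝓘(ℝ, E) φ x (ContinuousLinearMap.id ℝ E) := by
    have := (mdifferentiableAt_extChartAt (I := 𝓘(ℝ, E)) (mem_chart_source E x)).hasMFDerivAt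
    rwa [mfderiv_extChartAt_self] at this
  have hφγ : HasDerivAt (φ ∘ γ) (V x) t₀ := by
    let v : E := V x
    have h : HasFDerivAt (φ ∘ γ)
        ((ContinuousLinearMap.id ℝ E).comp ((1 : ℝ →L[ℝ] ℝ).smulRight v)) t₀ :=
      hasMFDerivAt_iff_hasFDerivAt.1 (HasMFDerivAt.comp t₀ hφd hγ)
    exact h.hasDerivAt.congr_deriv (one_smul ℝ v)
  have hmain := HasFDerivAt.comp_hasDerivAt t₀ hL hφγ
  have ev := (hγ.continuousAt.eventually key).mono (fun t ht => (ht W).symm)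
  have hinv : ∀ A : E →L[ℝ] E, A = ContinuousLinearMap.id ℝ E → ∀ v, A.inverse v = v := by
    rintro _ rfl v
    rw [ContinuousLinearMap.inverse_id, ContinuousLinearMap.id_apply]
  have hpull : ∀ U : Π y : M, TangentSpace 𝓘(ℝ, E) y,
      (mpullbackWithin 𝓘(ℝ, E) 𝓘(ℝ, E) φ.symm U (range 𝓘(ℝ, E)) (φ x) : E) = U x := fun U =>
    (hinv _ mfderivWithin_range_extChartAt_symm _).trans (congrArg (fun y => (U y : E)) xs)
  have hbr : lieBracket ℝ V' W' (φ x) = mlieBracket 𝓘(ℝ, E) V W x := by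
    refine Eq.trans ?_ (hinv _ mfderiv_extChartAt_self
      (lieBracketWithin ℝ V' W' (φ.symm ⁻¹' univ ∩ range 𝓘(ℝ, E)) (φ x))).symm
    rw [preimage_univ, univ_inter, modelWithCornersSelf_coe, range_id, lieBracketWithin_univ]
  refine (hmain.congr_of_eventuallyEq ev).congr_deriv ?_
  have hV'x : V' (φ x) = V x := hpull V
  rw [← hV'x, hLV, ← key.self_of_nhds (mlieBracket 𝓘(ℝ, E) V W), hbr]
  exact congrArg _ (hpull (mlieBracket 𝓘(ℝ, E) V W)).symm

end VectorFields
-- Left-invariant fields, the Lie algebra of `H`, and invariant metrics on `G ⧸ H`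
section HomogeneousSpaces

variable {E : Type*} [NormedAddCommGroup E] [NormedSpace ℝ E]
  {F : Type*} [NormedAddCommGroup F] [NormedSpace ℝ F]
  {G : Type*} [TopologicalSpace G] [ChartedSpace E G] [Group G]
  {H : Subgroup G} [ChartedSpace F (G ⧸ H)]

namespace IsHomogeneousManifold

theorem mdifferentiableAt_mk (hM : IsHomogeneousManifold E F H) (a : G) :
    MDifferentiableAt 𝓘(ℝ, E) 𝓘(ℝ, F) (fun g : G => (g : G ⧸ H)) a :=
  hM.contMDiff_mk.contMDiffAt.mdifferentiableAt (by simp)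

theorem mdifferentiableAt_smul (hM : IsHomogeneousManifold E F H) (a : G) (x : G ⧸ H) :
    MDifferentiableAt 𝓘(ℝ, F) 𝓘(ℝ, F) (fun y : G ⧸ H => a • y) x := by
  have h : ContMDiff 𝓘(ℝ, F) 𝓘(ℝ, F) ∞ (fun y : G ⧸ H => a • y) :=
    hM.contMDiff_smul.comp (contMDiff_const.prodMk contMDiff_id)
  exact h.contMDiffAt.mdifferentiableAt (by simp)

/-- The Lie algebra of `H` is contained in the kernel of the projection `𝔤 → T(G ⧸ H)`. -/
theorem mfderiv_mk_eq_zero (hM : IsHomogeneousManifold E F H) {X : GroupLieAlgebra 𝓘(ℝ, E) G}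
    (hX : X ∈ subgroupLieAlgebra H) :
    mfderiv 𝓘(ℝ, E) 𝓘(ℝ, F) (fun g : G => (g : G ⧸ H)) 1 X = 0 := by
  obtain ⟨γ, h1, hγ, hH⟩ := hX
  have hc : (fun g : G => (g : G ⧸ H)) ∘ γ = fun _ => ((1 : G) : G ⧸ H) := by
    ext t
    exact QuotientGroup.eq.2 (by simpa using hH t)
  have hd := HasMFDerivAt.comp 0 (hM.mdifferentiableAt_mk (γ 0)).hasMFDerivAt (hγ 0)
  rw [hc] at hd
  have h0 := hasMFDerivAt_unique hd (hasMFDerivAt_const _ _)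
  have h0' : (mfderiv 𝓘(ℝ, E) 𝓘(ℝ, F) (fun g : G => (g : G ⧸ H)) (γ 0)
      ((1 : ℝ) • mulInvariantVectorField X (γ 0)) : F) = 0 := DFunLike.congr_fun h0 (1 : ℝ)
  rw [one_smul] at h0'
  have h2 : (mfderiv 𝓘(ℝ, E) 𝓘(ℝ, F) (fun g : G => (g : G ⧸ H)) (γ 0)
      (mulInvariantVectorField X (γ 0)) : F) = mfderiv 𝓘(ℝ, E) 𝓘(ℝ, F)
      (fun g : G => (g : G ⧸ H)) 1 (mulInvariantVectorField X (1 : G)) := by rw [h1]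
  have h3 : mulInvariantVectorField X (1 : G) = X := by
    have : (fun y : G => 1 * y) = id := by ext y; exact one_mul y
    rw [mulInvariantVectorField, this, mfderiv_id]
    rfl
  rw [h3] at h2
  exact h2.symm.trans h0'

end IsHomogeneousManifold

variable [LieGroup 𝓘(ℝ, E) ∞ G]

theorem mdifferentiableAt_mul_left' (a b : G) :
    MDifferentiableAt 𝓘(ℝ, E) 𝓘(ℝ, E) (fun y : G => a * y) b :=
  (contMDiff_mul_left (I := 𝓘(ℝ, E)) (n := ∞)).contMDiffAt.mdifferentiableAt (by simp)

theorem contMDiff_one_mulInvariantVectorField (X : GroupLieAlgebra 𝓘(ℝ, E) G) :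
    ContMDiff 𝓘(ℝ, E) 𝓘(ℝ, E).tangent 1
      (fun g : G => (mulInvariantVectorField X g : TangentBundle 𝓘(ℝ, E) G)) :=
  (contMDiff_mulInvariantVectorField X).of_le (one_le_two.trans le_minSmoothness)

/-- The left-invariant vector fields are invariant under left translations. -/
theorem mfderiv_mul_left_mulInvariantVectorField (X : GroupLieAlgebra 𝓘(ℝ, E) G) (a b : G) :
    mfderiv 𝓘(ℝ, E) 𝓘(ℝ, E) (fun y : G => a * y) b (mulInvariantVectorField X b) =
      mulInvariantVectorField X (a * b) := by
  have h : (fun y : G => a * b * y) = (fun y : G => a * y) ∘ fun y : G => b * y := by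
    ext y; exact mul_assoc a b y
  have hc : mfderiv 𝓘(ℝ, E) 𝓘(ℝ, E) (fun y : G => a * b * y) 1 =
      (mfderiv 𝓘(ℝ, E) 𝓘(ℝ, E) (fun y : G => a * y) (b * 1)).comp
        (mfderiv 𝓘(ℝ, E) 𝓘(ℝ, E) (fun y : G => b * y) 1) := by
    rw [h]
    exact mfderiv_comp _ (mdifferentiableAt_mul_left' _ _) (mdifferentiableAt_mul_left' _ _)
  -- The tangent spaces at `b * 1` and `b` are different types; regarding both derivatives as maps
  -- `E →L[ℝ] E` allows them to be compared.
  have h1 : (mfderiv 𝓘(ℝ, E) 𝓘(ℝ, E) (fun y : G => a * y) (b * 1) : E →L[ℝ] E) =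
      mfderiv 𝓘(ℝ, E) 𝓘(ℝ, E) (fun y : G => a * y) b :=
    mfderiv_congr_point (mul_one b)
  exact (DFunLike.congr_fun h1 _).symm.trans (DFunLike.congr_fun hc X).symm

/-- Left-invariant vector fields are complete. -/
theorem exists_isMIntegralCurve_mulInvariantVectorField [T2Space G] [CompleteSpace E]
    (X : GroupLieAlgebra 𝓘(ℝ, E) G) :
    ∃ γ : ℝ → G, γ 0 = 1 ∧ IsMIntegralCurve (I := 𝓘(ℝ, E)) γ (mulInvariantVectorField X) := by
  have : IsManifold 𝓘(ℝ, E) ∞ G := ContMDiffMul.toIsManifold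
  have : IsManifold 𝓘(ℝ, E) 1 G := IsManifold.of_le (n := ∞) (by simp)
  have hX := contMDiff_one_mulInvariantVectorField X
  obtain ⟨γ, h1, hγ⟩ :=
    exists_isMIntegralCurveAt_of_contMDiffAt_boundaryless 0 (hX.contMDiffAt (x := (1 : G)))
  obtain ⟨ε, hε, hγ⟩ := isMIntegralCurveAt_iff'.1 hγ
  -- Left translation by `x` carries the local integral curve through `1` to one through `x` with
  -- the same lifetime `ε`. A uniform lifetime implies completeness.
  refine exists_isMIntegralCurve_of_isMIntegralCurveOn hX hε
    (fun x => ⟨fun t => x * γ t, by simp [h1], fun t ht => ?_⟩) 1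
  rw [Real.ball_eq_Ioo, zero_sub, zero_add] at hγ
  have hc := HasMFDerivAt.comp_hasMFDerivWithinAt t
    (mdifferentiableAt_mul_left' (E := E) x (γ t)).hasMFDerivAt (hγ t ht)
  refine hc.congr_mfderiv (ContinuousLinearMap.ext fun (s : ℝ) => Eq.symm ?_)
  change s • mulInvariantVectorField X (x * γ t) =
    mfderiv 𝓘(ℝ, E) 𝓘(ℝ, E) (fun y : G => x * y) (γ t) (s • mulInvariantVectorField X (γ t))
  rw [map_smul, mfderiv_mul_left_mulInvariantVectorField]

namespace IsHomogeneousManifold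

/-- The image in `G ⧸ H` of a left-invariant vector field at `a` is the translate by `a` of its
image at the base point. -/
theorem mfderiv_mk_mulInvariantVectorField (hM : IsHomogeneousManifold E F H)
    (X : GroupLieAlgebra 𝓘(ℝ, E) G) (a : G) :
    (mfderiv 𝓘(ℝ, E) 𝓘(ℝ, F) (fun g : G => (g : G ⧸ H)) a (mulInvariantVectorField X a) : F) =
      mfderiv 𝓘(ℝ, F) 𝓘(ℝ, F) (fun y : G ⧸ H => a • y) ((1 : G) : G ⧸ H)
        (mfderiv 𝓘(ℝ, E) 𝓘(ℝ, F) (fun g : G => (g : G ⧸ H)) 1 X) := by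
  have h1 : mfderiv 𝓘(ℝ, E) 𝓘(ℝ, F) ((fun g : G => (g : G ⧸ H)) ∘ fun y : G => a * y) 1 =
      (mfderiv 𝓘(ℝ, E) 𝓘(ℝ, F) (fun g : G => (g : G ⧸ H)) (a * 1)).comp
        (mfderiv 𝓘(ℝ, E) 𝓘(ℝ, E) (fun y : G => a * y) 1) :=
    mfderiv_comp _ (hM.mdifferentiableAt_mk _) (mdifferentiableAt_mul_left' _ _)
  have h2 : mfderiv 𝓘(ℝ, E) 𝓘(ℝ, F) ((fun y : G ⧸ H => a • y) ∘ fun g : G => (g : G ⧸ H)) 1 =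
      (mfderiv 𝓘(ℝ, F) 𝓘(ℝ, F) (fun y : G ⧸ H => a • y) ((1 : G) : G ⧸ H)).comp
        (mfderiv 𝓘(ℝ, E) 𝓘(ℝ, F) (fun g : G => (g : G ⧸ H)) 1) :=
    mfderiv_comp _ (hM.mdifferentiableAt_smul _ _) (hM.mdifferentiableAt_mk _)
  have h3 : (mfderiv 𝓘(ℝ, E) 𝓘(ℝ, F) (fun g : G => (g : G ⧸ H)) (a * 1) : E →L[ℝ] F) =
      mfderiv 𝓘(ℝ, E) 𝓘(ℝ, F) (fun g : G => (g : G ⧸ H)) a :=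
    mfderiv_congr_point (mul_one a)
  exact (DFunLike.congr_fun h3 _).symm.trans
    ((DFunLike.congr_fun h1 X).symm.trans (DFunLike.congr_fun h2 X))

/-- The kernel of the projection `𝔤 → T(G ⧸ H)` is contained in the Lie algebra of `H`. -/
theorem mem_subgroupLieAlgebra [T2Space G] [CompleteSpace E] [CompleteSpace F]
    [IsManifold 𝓘(ℝ, F) ∞ (G ⧸ H)]
    (hM : IsHomogeneousManifold E F H) {X : GroupLieAlgebra 𝓘(ℝ, E) G}
    (hX : mfderiv 𝓘(ℝ, E) 𝓘(ℝ, F) (fun g : G => (g : G ⧸ H)) 1 X = 0) :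
    X ∈ subgroupLieAlgebra H := by
  have : IsManifold 𝓘(ℝ, F) 1 (G ⧸ H) := IsManifold.of_le (n := ∞) (by simp)
  obtain ⟨γ, h1, hγ⟩ := exists_isMIntegralCurve_mulInvariantVectorField X
  refine ⟨γ, h1, hγ, fun t => ?_⟩
  set c : ℝ → G ⧸ H := fun t => (γ t : G ⧸ H) with hc
  -- The velocity of the projected curve is the translate by `γ s` of `dπ X = 0`.
  have hcur : IsMIntegralCurve (I := 𝓘(ℝ, F)) c (fun _ => 0) := by
    intro s
    have hd := HasMFDerivAt.comp s (hM.mdifferentiableAt_mk (γ s)).hasMFDerivAt (hγ s)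
    refine hd.congr_mfderiv (ContinuousLinearMap.ext fun (r : ℝ) => Eq.symm ?_)
    change r • (0 : F) = mfderiv 𝓘(ℝ, E) 𝓘(ℝ, F) (fun g : G => (g : G ⧸ H)) (γ s)
      (r • mulInvariantVectorField X (γ s))
    rw [map_smul]
    refine congrArg (r • ·) ?_
    rw [hM.mfderiv_mk_mulInvariantVectorField, hX]
    exact (map_zero _).symm
  -- Constant curves are also integral curves of the zero field, so uniqueness applies locally;
  -- connectedness of `ℝ` then gives `c t = c 0`.
  have hloc : IsLocallyConstant c := by
    refine (IsLocallyConstant.iff_eventually_eq c).2 fun s => ?_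
    refine isMIntegralCurveAt_eventuallyEq_of_contMDiffAt_boundaryless (I := 𝓘(ℝ, F))
      (γ' := fun _ => c s) (v := fun _ => 0)
      (Bundle.contMDiff_zeroSection ℝ (TangentSpace 𝓘(ℝ, F))).contMDiffAt
      (hcur.isMIntegralCurveAt s) (IsMIntegralCurve.isMIntegralCurveAt (fun r => ?_) s) rfl
    exact (hasMFDerivAt_const (I := 𝓘(ℝ, ℝ)) (I' := 𝓘(ℝ, F)) (c s) r).congr_mfderiv
      (ContinuousLinearMap.ext fun (x : ℝ) => (smul_zero (A := F) x).symm)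
  have h := hloc.apply_eq_of_preconnectedSpace 0 t
  rw [hc] at h
  simpa [h1] using QuotientGroup.eq.1 h

/-- The derivative at `0` of `t ↦ dπ (L_Y (γ t))`, where `γ` is the one-parameter subgroup of `H`
generated by `X`, is `dπ [X, Y]`. -/
theorem hasDerivAt_mfderiv_mk [CompleteSpace E] [IsManifold 𝓘(ℝ, F) ∞ (G ⧸ H)]
    (hM : IsHomogeneousManifold E F H) {X : GroupLieAlgebra 𝓘(ℝ, E) G} {γ : ℝ → G}
    (h1 : γ 0 = 1) (hγ : IsMIntegralCurve (I := 𝓘(ℝ, E)) γ (mulInvariantVectorField X))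
    (hH : ∀ t, γ t ∈ H) (Y : GroupLieAlgebra 𝓘(ℝ, E) G) :
    HasDerivAt (fun t => (mfderiv 𝓘(ℝ, E) 𝓘(ℝ, F) (fun g : G => (g : G ⧸ H)) (γ t)
        (mulInvariantVectorField Y (γ t)) : F))
      (mfderiv 𝓘(ℝ, E) 𝓘(ℝ, F) (fun g : G => (g : G ⧸ H)) 1 ⁅X, Y⁆) 0 := by
  have : IsManifold 𝓘(ℝ, E) ∞ G := ContMDiffMul.toIsManifold
  have : IsManifold 𝓘(ℝ, E) 2 G := IsManifold.of_le (n := ∞) ENat.LEInfty.out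
  have : IsManifold 𝓘(ℝ, F) 2 (G ⧸ H) := IsManifold.of_le (n := ∞) ENat.LEInfty.out
  have : IsManifold 𝓘(ℝ, F) 1 (G ⧸ H) := IsManifold.of_le (n := ∞) (by simp)
  set o : G ⧸ H := ((1 : G) : G ⧸ H) with ho
  -- Composing with the chart at `o` makes the map vector-valued. Since `π ∘ γ` stays at `o`, where
  -- the derivative of `ψ` is the identity, the quantity differentiated is unchanged.
  let ψ : G ⧸ H → F := extChartAt 𝓘(ℝ, F) o
  set π : G → G ⧸ H := fun g => (g : G ⧸ H) with hπ
  have hπγ : ∀ t, π (γ t) = o := fun t => QuotientGroup.eq.2 (by simpa using hH t)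
  have hπX : mfderiv 𝓘(ℝ, E) 𝓘(ℝ, F) π 1 X = 0 := hM.mfderiv_mk_eq_zero ⟨γ, h1, hγ, hH⟩
  have hcomp : ∀ a : G, π a ∈ (chartAt F o).source →
      mfderiv 𝓘(ℝ, E) 𝓘(ℝ, F) (ψ ∘ π) a =
        (mfderiv 𝓘(ℝ, F) 𝓘(ℝ, F) ψ (π a)).comp (mfderiv 𝓘(ℝ, E) 𝓘(ℝ, F) π a) := fun a ha =>
    mfderiv_comp _ (mdifferentiableAt_extChartAt ha) (hM.mdifferentiableAt_mk a)
  have hψo : ∀ x, x = o → (mfderiv 𝓘(ℝ, F) 𝓘(ℝ, F) ψ x : F →L[ℝ] F) =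
      ContinuousLinearMap.id ℝ F := by
    rintro x rfl
    exact mfderiv_extChartAt_self
  have hcγ : ∀ t (v : E), (mfderiv 𝓘(ℝ, E) 𝓘(ℝ, F) (ψ ∘ π) (γ t) v : F) =
      mfderiv 𝓘(ℝ, E) 𝓘(ℝ, F) π (γ t) v := by
    intro t v
    have hs : π (γ t) ∈ (chartAt F o).source := by
      rw [hπγ]; exact mem_chart_source F o
    exact (DFunLike.congr_fun (hcomp _ hs) v).trans (DFunLike.congr_fun (hψo _ (hπγ t)) _)
  have hf : ContMDiffAt 𝓘(ℝ, E) 𝓘(ℝ, F) 2 (ψ ∘ π) (γ 0) := by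
    have h2 : ContMDiffAt 𝓘(ℝ, F) 𝓘(ℝ, F) 2 ψ (π (γ 0)) := by
      rw [hπγ]; exact contMDiffAt_extChartAt
    exact h2.comp _ ((hM.contMDiff_mk.of_le ENat.LEInfty.out).contMDiffAt)
  -- The vanishing is needed on a neighbourhood, not only along `γ`. It holds because `dπ` of the
  -- left-invariant field of `X` at any `y` is the translate of `dπ X = 0`.
  have h0 : ∀ᶠ y in 𝓝 (γ 0),
      mfderiv 𝓘(ℝ, E) 𝓘(ℝ, F) (ψ ∘ π) y (mulInvariantVectorField X y) = 0 := by
    have hs : ∀ᶠ y in 𝓝 (γ 0), π y ∈ (chartAt F o).source := by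
      refine (hM.contMDiff_mk.continuous.continuousAt (x := γ 0)).eventually_mem ?_
      change _ ∈ 𝓝 (π (γ 0))
      rw [hπγ]
      exact (chartAt F o).open_source.mem_nhds (mem_chart_source F o)
    filter_upwards [hs] with y hy
    refine (DFunLike.congr_fun (hcomp y hy) _).trans ?_
    have h3 : mfderiv 𝓘(ℝ, E) 𝓘(ℝ, F) π y (mulInvariantVectorField X y) = 0 :=
      (hM.mfderiv_mk_mulInvariantVectorField X y).trans (by rw [hπX]; exact map_zero _)
    exact (congrArg (mfderiv 𝓘(ℝ, F) 𝓘(ℝ, F) ψ (π y)) h3).trans (map_zero _)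
  have hmain := hasDerivAt_mfderiv_apply_mlieBracket hf
    (mdifferentiableAt_mulInvariantVectorField X) (mdifferentiableAt_mulInvariantVectorField Y)
    h0 (hγ 0)
  refine (hmain.congr_of_eventuallyEq (Eventually.of_forall fun t => (hcγ t _).symm)).congr_deriv ?_
  refine (hcγ 0 _).trans ?_
  rw [h1]
  rfl

/-- The pullback to `𝔤` of an invariant metric at the base point of `G ⧸ H` is invariant under the
Lie algebra of `H`. -/
theorem form_lie_add_form_lie [CompleteSpace E] [IsManifold 𝓘(ℝ, F) ∞ (G ⧸ H)]
    (hM : IsHomogeneousManifold E F H) {g : PseudoRiemannianMetric F (G ⧸ H)}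
    (hg : g.IsInvariant G) {X : GroupLieAlgebra 𝓘(ℝ, E) G} (hX : X ∈ subgroupLieAlgebra H)
    (Y W : GroupLieAlgebra 𝓘(ℝ, E) G) :
    g.form ((1 : G) : G ⧸ H) (mfderiv 𝓘(ℝ, E) 𝓘(ℝ, F) (fun g : G => (g : G ⧸ H)) 1 ⁅X, Y⁆)
        (mfderiv 𝓘(ℝ, E) 𝓘(ℝ, F) (fun g : G => (g : G ⧸ H)) 1 W) +
      g.form ((1 : G) : G ⧸ H) (mfderiv 𝓘(ℝ, E) 𝓘(ℝ, F) (fun g : G => (g : G ⧸ H)) 1 Y)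
        (mfderiv 𝓘(ℝ, E) 𝓘(ℝ, F) (fun g : G => (g : G ⧸ H)) 1 ⁅X, W⁆) = 0 := by
  obtain ⟨γ, h1, hγ, hH⟩ := hX
  set o : G ⧸ H := ((1 : G) : G ⧸ H) with ho
  set π : G → G ⧸ H := fun g => (g : G ⧸ H) with hπ
  let B : F →L[ℝ] F →L[ℝ] ℝ := g.form o
  let u : GroupLieAlgebra 𝓘(ℝ, E) G → ℝ → F := fun Z t =>
    mfderiv 𝓘(ℝ, E) 𝓘(ℝ, F) π (γ t) (mulInvariantVectorField Z (γ t))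
  have hu : ∀ Z t, u Z t = mfderiv 𝓘(ℝ, F) 𝓘(ℝ, F) (fun y : G ⧸ H => γ t • y) o
      (mfderiv 𝓘(ℝ, E) 𝓘(ℝ, F) π 1 Z) := fun Z t =>
    hM.mfderiv_mk_mulInvariantVectorField Z (γ t)
  have hu0 : ∀ Z, u Z 0 = mfderiv 𝓘(ℝ, E) 𝓘(ℝ, F) π 1 Z := by
    intro Z
    have hid : (fun y : G ⧸ H => (1 : G) • y) = id := by ext y; exact one_smul G y
    rw [hu, h1, hid, mfderiv_id]
    rfl
  have hdu : ∀ Z, HasDerivAt (u Z) (mfderiv 𝓘(ℝ, E) 𝓘(ℝ, F) π 1 ⁅X, Z⁆) 0 := fun Z =>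
    hM.hasDerivAt_mfderiv_mk h1 hγ hH Z
  have hB : ∀ t, (g.form (γ t • o) : F →L[ℝ] F →L[ℝ] ℝ) = B := by
    intro t
    have : γ t • o = o := QuotientGroup.eq.2 (by simpa using hH t)
    rw [this]
  -- `γ t` fixes `o` and acts by isometries, and `u Z t` is the image of `dπ Z` under its
  -- differential. The product rule at `t = 0` then gives the identity.
  have hconst : ∀ t, B (u Y t) (u W t) = B (mfderiv 𝓘(ℝ, E) 𝓘(ℝ, F) π 1 Y)
      (mfderiv 𝓘(ℝ, E) 𝓘(ℝ, F) π 1 W) := by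
    intro t
    rw [hu, hu]
    exact (DFunLike.congr_fun (DFunLike.congr_fun (hB t) _) _).symm.trans (hg (γ t) o _ _)
  have hd := B.hasDerivAt_of_bilinear (fun _ => hdu Y) (fun _ => hdu W)
  simp only [hconst] at hd
  have h := hd.unique (hasDerivAt_const _ _)
  rw [hu0, hu0, add_comm] at h
  exact h

end IsHomogeneousManifold

end HomogeneousSpaces
-- Degeneracy of invariant forms and the main theorem
/-- If `D` is skew-adjoint for the bilinear form `β` and `D ∘ D = c • D` with `c ≠ 0`, then the
eigenvectors of `D` for the eigenvalue `c` are in the left kernel of `β`. -/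
theorem LinearMap.BilinForm.apply_eq_zero_of_skew_of_eigenvector {V : Type*} [AddCommGroup V]
    [Module ℝ V] {β : LinearMap.BilinForm ℝ V} {D : V → V} {c : ℝ} (hc : c ≠ 0)
    (hD : ∀ v, D (D v) = c • D v) (hβ : ∀ v w, β (D v) w + β v (D w) = 0) {k : V}
    (hk : D k = c • k) (w : V) : β k w = 0 := by
  have h1 : ∀ w, c * β k w + β k (D w) = 0 := fun w => by
    have := hβ k w
    rwa [hk, map_smul, LinearMap.smul_apply, smul_eq_mul] at this
  -- Replacing `w` by `D w` in `h1` gives `2c β(k, D w) = 0`; the term `β(k, D w)` then drops out of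
  -- `h1` for `w`.
  have h2 : c * β k (D w) = 0 := by
    have := h1 (D w)
    rw [hD, map_smul, smul_eq_mul] at this
    linarith
  have h3 := h1 w
  rw [(mul_eq_zero.1 h2).resolve_left hc, add_zero] at h3
  exact (mul_eq_zero.1 h3).resolve_left hc

namespace DualLie

open LorentzLie

variable {Λ z : ℝ}

/-- The element of the dual basis of `𝔤*` with index `i`. -/
noncomputable def dualGen (Λ z : ℝ) (i : Fin 6) : DualLie Λ z := (gen Λ).coord i

theorem dualGen_apply (i j : Fin 6) : dualGen Λ z i (gen Λ j) = if j = i then 1 else 0 := by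
  change (gen Λ).coord i (gen Λ j) = _
  rw [Module.Basis.coord_apply, Module.Basis.repr_self, Finsupp.single_apply]

theorem dualGen_zero_mem_hPerp : dualGen Λ z 0 ∈ hPerp Λ z := by
  simp [mem_hPerp, J, K1, K2, dualGen_apply]

theorem dualGen_three_mem_tPerp : dualGen Λ z 3 ∈ tPerp Λ z := by
  simp [mem_tPerp, P0, P1, P2, dualGen_apply]

theorem dualGen_three_apply_K1 : dualGen Λ z 3 (K1 Λ) = 1 := by
  simp [K1, dualGen_apply]

theorem lie_dualGen_zero_three : ⁅dualGen Λ z 0, dualGen Λ z 3⁆ = (-z) • dualGen Λ z 3 := by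
  apply ext_gen <;> simp only [smul_apply, lie_P0, lie_P1, lie_P2, lie_K1, lie_K2, lie_J] <;>
    simp [P0, P1, P2, K1, K2, J, dualGen_apply]

/-- The dual element of `P₀` kills the dual elements of `P₀` and `J` and scales those of `P₁, P₂,
K₁, K₂` by `-z`. Its adjoint action is thus `-z` times a projection, for every `Λ`. -/
theorem lie_dualGen_zero_lie (φ : DualLie Λ z) :
    ⁅dualGen Λ z 0, ⁅dualGen Λ z 0, φ⁆⁆ = (-z) • ⁅dualGen Λ z 0, φ⁆ := by
  apply ext_gen <;> simp only [smul_apply, lie_P0, lie_P1, lie_P2, lie_K1, lie_K2, lie_J] <;>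
    simp [P0, P1, P2, K1, K2, J, dualGen_apply]

/-- Every `ad_{𝔥^⊥}`-invariant bilinear form on `𝔱^⊥` is degenerate. -/
theorem not_nondegenerate_of_isAdInvariant (hz : z ≠ 0) {B : LinearMap.BilinForm ℝ (tPerp Λ z)}
    (hB : IsAdInvariant B) : ¬ B.Nondegenerate := by
  intro hn
  have h := LinearMap.BilinForm.apply_eq_zero_of_skew_of_eigenvector (β := B)
    (D := isotropyAd ⟨dualGen Λ z 0, dualGen_zero_mem_hPerp⟩) (neg_ne_zero.2 hz)
    (fun v => Subtype.ext (lie_dualGen_zero_lie (v : DualLie Λ z))) (hB _)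
    (k := ⟨dualGen Λ z 3, dualGen_three_mem_tPerp⟩) (Subtype.ext lie_dualGen_zero_three)
  have h0 := congrArg Subtype.val (hn.1 _ h)
  have h1 := dualGen_three_apply_K1 (Λ := Λ) (z := z)
  change dualGen Λ z 3 = 0 at h0
  rw [h0, zero_apply] at h1
  exact zero_ne_one h1

end DualLie

/-- An invariant pseudo-Riemannian metric on `G ⧸ H` cannot exist if `𝔤 ≃ 𝔤*` identifies the Lie
algebra of `H` with `𝔥^⊥`. -/
theorem IsHomogeneousManifold.not_isInvariant {Λ z : ℝ} (hz : z ≠ 0)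
    {E : Type*} [NormedAddCommGroup E] [NormedSpace ℝ E] [CompleteSpace E]
    {G : Type*} [TopologicalSpace G] [T2Space G] [ChartedSpace E G] [Group G]
    [LieGroup 𝓘(ℝ, E) ∞ G] (e : GroupLieAlgebra 𝓘(ℝ, E) G ≃ₗ⁅ℝ⁆ DualLie Λ z) {H : Subgroup G}
    (hH : subgroupLieAlgebra H = {X : GroupLieAlgebra 𝓘(ℝ, E) G | e X ∈ DualLie.hPerp Λ z})
    {F : Type*} [NormedAddCommGroup F] [NormedSpace ℝ F] [CompleteSpace F]
    [ChartedSpace F (G ⧸ H)] [IsManifold 𝓘(ℝ, F) ∞ (G ⧸ H)]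
    (hM : IsHomogeneousManifold E F H) (g : PseudoRiemannianMetric F (G ⧸ H)) :
    ¬ g.IsInvariant G := by
  intro hg
  let P : GroupLieAlgebra 𝓘(ℝ, E) G →L[ℝ] TangentSpace 𝓘(ℝ, F) ((1 : G) : G ⧸ H) :=
    mfderiv 𝓘(ℝ, E) 𝓘(ℝ, F) (fun g : G => (g : G ⧸ H)) 1
  let p := e.symm (DualLie.dualGen Λ z 0)
  let k := e.symm (DualLie.dualGen Λ z 3)
  -- The form lives on the whole Lie algebra, with `Lie H` in its kernel, so no identification of
  -- the tangent space with `𝔱^⊥` is needed.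
  let β : LinearMap.BilinForm ℝ (GroupLieAlgebra 𝓘(ℝ, E) G) :=
    LinearMap.mk₂ ℝ (fun Y W => g.form _ (P Y) (P W))
      (fun _ _ _ => by simp only [map_add, add_apply])
      (fun _ _ _ => by simp only [map_smul, smul_apply])
      (fun _ _ _ => by simp only [map_add])
      (fun _ _ _ => by simp only [map_smul])
  have hsymm : ∀ φ : DualLie Λ z, e.symm ((-z) • φ) = (-z) • e.symm φ := fun φ =>
    e.symm.toLinearEquiv.map_smul _ φ
  have hp : p ∈ subgroupLieAlgebra H := by
    rw [hH]
    change e (e.symm (DualLie.dualGen Λ z 0)) ∈ DualLie.hPerp Λ z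
    rw [e.apply_symm_apply]
    exact DualLie.dualGen_zero_mem_hPerp
  have hpk : ⁅p, k⁆ = (-z) • k := by
    rw [← hsymm, ← DualLie.lie_dualGen_zero_three]
    exact (e.symm.map_lie _ _).symm
  have hpp : ∀ v : GroupLieAlgebra 𝓘(ℝ, E) G, ⁅p, ⁅p, v⁆⁆ = (-z) • ⁅p, v⁆ := by
    intro v
    obtain ⟨φ, rfl⟩ : ∃ φ, e.symm φ = v := e.symm.surjective v
    have h : ∀ ψ, ⁅p, e.symm ψ⁆ = e.symm ⁅DualLie.dualGen Λ z 0, ψ⁆ := fun ψ =>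
      (e.symm.map_lie _ _).symm
    rw [h, h, DualLie.lie_dualGen_zero_lie, hsymm]
  have hk := LinearMap.BilinForm.apply_eq_zero_of_skew_of_eigenvector (β := β)
    (D := fun Y => ⁅p, Y⁆) (neg_ne_zero.2 hz) hpp (hM.form_lie_add_form_lie hg hp) hpk
  -- Every tangent vector at the base point is some `P W`, and `β k W = 0` for all `W`.
  have hPk : P k = 0 := g.nondegenerate _ _ fun w => by
    obtain ⟨W, rfl⟩ := hM.surjective_mfderiv_mk 1 w
    exact hk W
  have hkH := hM.mem_subgroupLieAlgebra hPk
  rw [hH] at hkH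
  change e (e.symm (DualLie.dualGen Λ z 3)) ∈ DualLie.hPerp Λ z at hkH
  rw [e.apply_symm_apply] at hkH
  exact one_ne_zero (DualLie.dualGen_three_apply_K1.symm.trans (DualLie.mem_hPerp.1 hkH).2.1)

theorem mainTheorem6 (Λ z : ℝ) (hz : z ≠ 0) :
    -- the dual homogeneous space carries no invariant metric
    (∀ (E : Type*) [NormedAddCommGroup E] [NormedSpace ℝ E] [FiniteDimensional ℝ E]
      (G : Type*) [TopologicalSpace G] [T2Space G] [ChartedSpace E G] [Group G]
      [LieGroup 𝓘(ℝ, E) ∞ G]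
      (e : GroupLieAlgebra 𝓘(ℝ, E) G ≃ₗ⁅ℝ⁆ DualLie Λ z)
      (H : Subgroup G), IsClosed (H : Set G) →
      (subgroupLieAlgebra H = {X : GroupLieAlgebra 𝓘(ℝ, E) G | e X ∈ DualLie.hPerp Λ z}) →
      ∀ (F : Type*) [NormedAddCommGroup F] [NormedSpace ℝ F] [FiniteDimensional ℝ F]
        [ChartedSpace F (G ⧸ H)] [IsManifold 𝓘(ℝ, F) ∞ (G ⧸ H)],
        IsHomogeneousManifold E F H →
        ¬ ∃ g : PseudoRiemannianMetric F (G ⧸ H), g.IsInvariant G) ∧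
    -- equivalently, there is no invariant nondegenerate symmetric form on the tangent space
    (¬ ∃ B : LinearMap.BilinForm ℝ (DualLie.tPerp Λ z),
        B.IsSymm ∧ B.Nondegenerate ∧ DualLie.IsAdInvariant B) := by

  refine ⟨?_, fun ⟨B, _, hn, hB⟩ => DualLie.not_nondegenerate_of_isAdInvariant hz hB hn⟩
  intro E _ _ _ G _ _ _ _ _ e H _ hH F _ _ _ _ _ hM ⟨g, hg⟩
  have := FiniteDimensional.complete ℝ E
  have := FiniteDimensional.complete ℝ F
  exact hM.not_isInvariant hz e hH g hg
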